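/- Let $\mathcal H$ be a complex Hilbert space. A \emph{reflection} on $\mathcal H$ is a Hermitian operator $R$ with $R^2 = I$, and a \emph{qubit} in $\mathcal H$ is a pair $(X, Z)$ of reflections on $\mathcal H$ that anti-commute, $XZ + ZX = 0$. The \emph{overlap} of two qubits $(X_1, Z_1)$ and $(X_2, Z_2)$ is $\max_{S, T \in \{X, Z\}} \|[S_1, T_2]\|$, where $[S, T] = ST - TS$ and $\|\cdot\|$ is the operator norm. Let $n \ge 1$ be an integer, suppose $\dim \mathcal H = 2^n$, and let $\epsilon < 1$ be a real number with $\epsilon/(1-\epsilon)^2 \le 1/(64 n)$. If $(X_1, Z_1), \ldots, (X_m, Z_m)$ are qubits in $\mathcal H$ whose pairwise overlaps are at most $\epsilon$, that is, $\|[S_i, T_j]\| \le \epsilon$ for all $i \ne j$ and all $S, T \in \{X, Z\}$, then $m \le n$. -/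

import Mathlib

/-- A reflection on a complex Hilbert space: a Hermitian (bounded) operator that squares to the
identity. -/
def IsHermitianReflection {H : Type*} [NormedAddCommGroup H] [InnerProductSpace ℂ H]
    [CompleteSpace H] (R : H →L[ℂ] H) : Prop :=
  IsSelfAdjoint R ∧ R * R = 1

/-- A qubit in a Hilbert space `H`: a pair `(X, Z)` of anti-commuting reflections on `H`. -/
structure Qubit (H : Type*) [NormedAddCommGroup H] [InnerProductSpace ℂ H]
    [CompleteSpace H] where
  /-- The first reflection. -/
  X : H →L[ℂ] H
  /-- The second reflection. -/
  Z : H →L[ℂ] H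
  isReflection_X : IsHermitianReflection X
  isReflection_Z : IsHermitianReflection Z
  anticommute : X * Z + Z * X = 0

/-- The overlap `max_{S, T ∈ {X, Z}} ‖[S₁, T₂]‖` of two qubits, where `[S, T] = S T - T S` and
the norm is the operator norm. -/
noncomputable def Qubit.overlap {H : Type*} [NormedAddCommGroup H] [InnerProductSpace ℂ H]
    [CompleteSpace H] (q₁ q₂ : Qubit H) : ℝ :=
  max (max ‖q₁.X * q₂.X - q₂.X * q₁.X‖ ‖q₁.X * q₂.Z - q₂.Z * q₁.X‖)
    (max ‖q₁.Z * q₂.X - q₂.X * q₁.Z‖ ‖q₁.Z * q₂.Z - q₂.Z * q₁.Z‖)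

/-!
Averaging over conjugation by `1`, `X`, `Z` and `XZ` (the *twirl* over the qubit `(X, Z)`) is a
conditional expectation `E` onto the commutant of the qubit. It moves an operator that commutes
with `X` and `Z` up to `ε` by at most `ε`, and `E ((a - E a) * (b - E b)) = E (a * b) - E a * E b`,
so twirling a second qubit destroys the relations `X² = Z² = 1` and `XZ + ZX = 0` only to second
order in `ε`. Replacing self-adjoint elements by their signs repairs these relations inside the
commutant, again at a cost of order `ε²`. The other qubits can therefore be moved to qubits that
commute exactly with the first one and have pairwise overlaps at most `ε + 30 * ε ^ 2`; they
restrict to the eigenspace of the first `Z` for the eigenvalue `1`, whose dimension is half of that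
of the whole space. Since `1 / ε` decreases by at most `30` in such a step, `30 * n * ε ≤ 1` allows
`n` steps.
-/

/-- A self-adjoint involution: `IsHermitianReflection` in an arbitrary monoid with a star, so that
the construction of nearby reflections takes place in an abstract C⋆-algebra. -/
structure IsReflection {A : Type*} [Monoid A] [Star A] (r : A) : Prop where
  isSelfAdjoint : IsSelfAdjoint r
  mul_self : r * r = 1

theorem IsReflection.mem_unitary {A : Type*} [Monoid A] [StarMul A] {r : A}
    (hr : IsReflection r) : r ∈ unitary A := by
  rw [Unitary.mem_iff, hr.isSelfAdjoint.star_eq, hr.mul_self, and_self]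

/-- The relations of the Pauli matrices `X` and `Z`, which hold for the two reflections of a
`Qubit`, in an arbitrary ring with a star. -/
structure IsPauliPair {A : Type*} [Ring A] [Star A] (x z : A) : Prop where
  left : IsReflection x
  right : IsReflection z
  anticommute : x * z + z * x = 0

section Pinch

variable {A : Type*} [Ring A] [Algebra ℝ A]

/-- The pinching `a ↦ (a + r * a * r) / 2`, which for `r * r = 1` projects onto the commutant of
`r`. -/
noncomputable def pinch (r : A) : A →ₗ[ℝ] A :=
  (1 / 2 : ℝ) • (LinearMap.id + LinearMap.mulLeftRight ℝ (r, r))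

theorem pinch_apply (r a : A) : pinch r a = (1 / 2 : ℝ) • (a + r * a * r) := by
  simp [pinch]

theorem pinch_mul_of_commute_right {r b : A} (h : Commute r b) (a : A) :
    pinch r (a * b) = pinch r a * b := by
  have conj_mul : r * (a * b) * r = r * a * r * b := by simp only [mul_assoc, h.eq]
  rw [pinch_apply, pinch_apply, smul_mul_assoc, add_mul, conj_mul]

theorem pinch_mul_of_commute_left {r a : A} (h : Commute r a) (b : A) :
    pinch r (a * b) = a * pinch r b := by
  have conj_mul : r * (a * b) * r = a * (r * b * r) := by simp only [← mul_assoc, h.eq]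
  rw [pinch_apply, pinch_apply, mul_smul_comm, mul_add, conj_mul]

theorem pinch_one {r : A} (hr : r * r = 1) : pinch r 1 = 1 := by
  rw [pinch_apply, mul_one, hr]
  module

theorem commute_pinch {r : A} (hr : r * r = 1) (a : A) : Commute r (pinch r a) := by
  have left_conj : r * (r * a * r) = a * r := by simp only [← mul_assoc, hr, one_mul]
  have conj_right : r * a * r * r = r * a := by rw [mul_assoc, hr, mul_one]
  rw [commute_iff_eq, pinch_apply, mul_smul_comm, smul_mul_assoc, mul_add, add_mul, left_conj,
    conj_right, add_comm]

theorem commute_pinch_of_commute {y r a : A} (hr : Commute y r) (ha : Commute y a) :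
    Commute y (pinch r a) := by
  rw [pinch_apply]
  exact (ha.add_right ((hr.mul_right ha).mul_right hr)).smul_right _

theorem commute_pinch_of_anticommute {y r a : A} (hr : y * r + r * y = 0) (ha : Commute y a) :
    Commute y (pinch r a) := by
  have yr : y * r = -(r * y) := eq_neg_of_add_eq_zero_left hr
  have conj : Commute y (r * a * r) := by
    calc y * (r * a * r) = (y * r) * a * r := by simp only [mul_assoc]
      _ = -(r * (y * a) * r) := by rw [yr]; noncomm_ring
      _ = -(r * a * (y * r)) := by rw [ha.eq]; simp only [mul_assoc]
      _ = r * a * r * y := by rw [yr]; noncomm_ring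
  rw [pinch_apply]
  exact (ha.add_right conj).smul_right _

theorem sub_pinch_anticommute {r : A} (hr : r * r = 1) (a : A) :
    r * (a - pinch r a) + (a - pinch r a) * r = 0 := by
  have left_conj : r * (r * a * r) = a * r := by simp only [← mul_assoc, hr, one_mul]
  have conj_right : r * a * r * r = r * a := by rw [mul_assoc, hr, mul_one]
  rw [pinch_apply, mul_sub, sub_mul, mul_smul_comm, smul_mul_assoc, mul_add, add_mul, left_conj,
    conj_right]
  module

theorem isSelfAdjoint_pinch [StarRing A] [StarModule ℝ A] {r a : A} (hr : IsSelfAdjoint r)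
    (ha : IsSelfAdjoint a) : IsSelfAdjoint (pinch r a) := by
  rw [pinch_apply]
  exact (IsSelfAdjoint.all _).smul (ha.add (ha.conjugate_self hr))

end Pinch

section Twirl

variable {A : Type*} [Ring A] [Algebra ℝ A]

/-- The twirl: the average of the conjugates of an element by `1`, `x`, `z` and `x * z`, which for a
Pauli pair `x`, `z` projects onto the commutant of the pair. It is encoded as the composition of the
two pinchings. -/
noncomputable def twirl (x z : A) : A →ₗ[ℝ] A := pinch x ∘ₗ pinch z

theorem twirl_apply (x z a : A) : twirl x z a = pinch x (pinch z a) := rfl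

theorem twirl_mul_of_commute_right {x z b : A} (hx : Commute x b) (hz : Commute z b) (a : A) :
    twirl x z (a * b) = twirl x z a * b := by
  simp only [twirl_apply, pinch_mul_of_commute_right hz, pinch_mul_of_commute_right hx]

theorem twirl_mul_of_commute_left {x z a : A} (hx : Commute x a) (hz : Commute z a) (b : A) :
    twirl x z (a * b) = a * twirl x z b := by
  simp only [twirl_apply, pinch_mul_of_commute_left hz, pinch_mul_of_commute_left hx]

namespace IsPauliPair

variable [Star A] {x z : A}

theorem twirl_one (h : IsPauliPair x z) : twirl x z 1 = 1 := by
  rw [twirl_apply, pinch_one h.right.mul_self, pinch_one h.left.mul_self]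

theorem commute_left_twirl (h : IsPauliPair x z) (a : A) : Commute x (twirl x z a) :=
  commute_pinch h.left.mul_self _

theorem commute_right_twirl (h : IsPauliPair x z) (a : A) : Commute z (twirl x z a) :=
  commute_pinch_of_anticommute (by rw [add_comm, h.anticommute]) (commute_pinch h.right.mul_self a)

theorem twirl_of_commute (h : IsPauliPair x z) {a : A} (hx : Commute x a) (hz : Commute z a) :
    twirl x z a = a := by
  simpa only [mul_one, h.twirl_one] using twirl_mul_of_commute_left hx hz 1

theorem twirl_sub_mul_sub (h : IsPauliPair x z) (a b : A) :
    twirl x z ((a - twirl x z a) * (b - twirl x z b)) =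
      twirl x z (a * b) - twirl x z a * twirl x z b := by
  have hxa := h.commute_left_twirl a
  have hza := h.commute_right_twirl a
  have hxb := h.commute_left_twirl b
  have hzb := h.commute_right_twirl b
  simp only [sub_mul, mul_sub, map_sub, twirl_mul_of_commute_left hxa hza,
    twirl_mul_of_commute_right hxb hzb, h.twirl_of_commute hxb hzb]
  abel

end IsPauliPair

theorem IsPauliPair.isSelfAdjoint_twirl [StarRing A] [StarModule ℝ A] {x z : A}
    (h : IsPauliPair x z) {a : A} (ha : IsSelfAdjoint a) : IsSelfAdjoint (twirl x z a) :=
  isSelfAdjoint_pinch h.left.isSelfAdjoint (isSelfAdjoint_pinch h.right.isSelfAdjoint ha)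

end Twirl

section NormedRing

variable {A : Type*} [NormedRing A]

theorem norm_commutator_le_of_norm_le_one {a b s t : A} (ha : ‖a‖ ≤ 1) (ht : ‖t‖ ≤ 1) :
    ‖s * t - t * s‖ ≤ ‖a * b - b * a‖ + 2 * ‖s - a‖ + 2 * ‖t - b‖ := by
  have decomposition : s * t - t * s =
      (a * b - b * a) + ((s - a) * t - t * (s - a)) + (a * (t - b) - (t - b) * a) := by
    noncomm_ring
  have hs : ‖(s - a) * t - t * (s - a)‖ ≤ 2 * ‖s - a‖ := by
    linarith [norm_sub_le ((s - a) * t) (t * (s - a)), norm_mul_le_of_le (le_refl ‖s - a‖) ht,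
      norm_mul_le_of_le ht (le_refl ‖s - a‖)]
  have hb : ‖a * (t - b) - (t - b) * a‖ ≤ 2 * ‖t - b‖ := by
    linarith [norm_sub_le (a * (t - b)) ((t - b) * a), norm_mul_le_of_le (le_refl ‖t - b‖) ha,
      norm_mul_le_of_le ha (le_refl ‖t - b‖)]
  rw [decomposition]
  exact norm_add₃_le.trans (by gcongr)

theorem norm_anticommutator_le_of_norm_le_one {a b x : A} (hb : ‖b‖ ≤ 1) :
    ‖x * b + b * x‖ ≤ ‖a * b + b * a‖ + 2 * ‖x - a‖ := by
  have decomposition : x * b + b * x = (a * b + b * a) + (x - a) * b + b * (x - a) := by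
    noncomm_ring
  rw [decomposition]
  linarith [norm_add₃_le (a := a * b + b * a) (b := (x - a) * b) (c := b * (x - a)),
    norm_mul_le_of_le (le_refl ‖x - a‖) hb, norm_mul_le_of_le hb (le_refl ‖x - a‖)]

theorem norm_mul_self_sub_one_le_of_norm_le_one {b c : A} (hb : ‖b‖ ≤ 1) (hc : ‖c‖ ≤ 1) :
    ‖c * c - 1‖ ≤ ‖b * b - 1‖ + 2 * ‖c - b‖ := by
  have decomposition : c * c - 1 = (b * b - 1) + c * (c - b) + (c - b) * b := by noncomm_ring
  rw [decomposition]
  linarith [norm_add₃_le (a := b * b - 1) (b := c * (c - b)) (c := (c - b) * b),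
    norm_mul_le_of_le hc (le_refl ‖c - b‖), norm_mul_le_of_le (le_refl ‖c - b‖) hb]

theorem isUnit_of_norm_mul_self_sub_one_lt_one [HasSummableGeomSeries A] {a : A}
    (h : ‖a * a - 1‖ < 1) : IsUnit a := by
  rw [← isUnit_mul_self_iff, ← sub_sub_cancel 1 (a * a)]
  exact isUnit_one_sub_of_norm_lt_one (by rwa [norm_sub_rev])

end NormedRing

section CStarRing

variable {A : Type*} [NormedRing A] [StarRing A] [CStarRing A]

theorem IsReflection.norm_le_one {r : A} (hr : IsReflection r) : ‖r‖ ≤ 1 := by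
  nontriviality A
  exact (CStarRing.norm_of_mem_unitary hr.mem_unitary).le

variable [NormedAlgebra ℝ A]

namespace IsReflection

variable {r : A}

theorem norm_pinch (hr : IsReflection r) (a : A) : ‖pinch r a‖ = ‖r * a + a * r‖ / 2 := by
  have factor : pinch r a = (1 / 2 : ℝ) • (r * (r * a + a * r)) := by
    rw [pinch_apply, mul_add, ← mul_assoc, ← mul_assoc, hr.mul_self, one_mul]
  rw [factor, norm_smul, Real.norm_of_nonneg (by norm_num),
    CStarRing.norm_mem_unitary_mul _ hr.mem_unitary, one_div_mul_eq_div]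

theorem norm_sub_pinch (hr : IsReflection r) (a : A) : ‖a - pinch r a‖ = ‖r * a - a * r‖ / 2 := by
  have factor : a - pinch r a = (1 / 2 : ℝ) • (r * (r * a - a * r)) := by
    rw [pinch_apply, mul_sub, ← mul_assoc, ← mul_assoc, hr.mul_self, one_mul]
    module
  rw [factor, norm_smul, Real.norm_of_nonneg (by norm_num),
    CStarRing.norm_mem_unitary_mul _ hr.mem_unitary, one_div_mul_eq_div]

theorem norm_pinch_le (hr : IsReflection r) (a : A) : ‖pinch r a‖ ≤ ‖a‖ := by
  rw [hr.norm_pinch]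
  linarith [norm_add_le (r * a) (a * r), CStarRing.norm_mem_unitary_mul a hr.mem_unitary,
    CStarRing.norm_mul_mem_unitary a hr.mem_unitary]

theorem norm_sub_pinch_le (hr : IsReflection r) (a : A) : ‖a - pinch r a‖ ≤ ‖a‖ := by
  rw [hr.norm_sub_pinch]
  linarith [norm_sub_le (r * a) (a * r), CStarRing.norm_mem_unitary_mul a hr.mem_unitary,
    CStarRing.norm_mul_mem_unitary a hr.mem_unitary]

end IsReflection

namespace IsPauliPair

variable {x z a b : A} {ε : ℝ}

theorem norm_twirl_le (h : IsPauliPair x z) (a : A) : ‖twirl x z a‖ ≤ ‖a‖ :=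
  (h.left.norm_pinch_le _).trans (h.right.norm_pinch_le _)

theorem norm_sub_twirl_le (h : IsPauliPair x z) (hx : ‖x * a - a * x‖ ≤ ε)
    (hz : ‖z * a - a * z‖ ≤ ε) : ‖a - twirl x z a‖ ≤ ε := by
  have hpinch : ‖pinch x a - twirl x z a‖ ≤ ‖z * a - a * z‖ / 2 := by
    rw [twirl_apply, ← map_sub, ← h.right.norm_sub_pinch]
    exact h.left.norm_pinch_le _
  linarith [norm_sub_le_norm_sub_add_norm_sub a (pinch x a) (twirl x z a), h.left.norm_sub_pinch a]

theorem norm_twirl_mul_twirl_sub_le (h : IsPauliPair x z) (ha : ‖a - twirl x z a‖ ≤ ε)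
    (hb : ‖b - twirl x z b‖ ≤ ε) :
    ‖twirl x z a * twirl x z b - twirl x z (a * b)‖ ≤ ε ^ 2 := by
  rw [norm_sub_rev, ← h.twirl_sub_mul_sub, sq]
  exact (h.norm_twirl_le _).trans (norm_mul_le_of_le ha hb)

theorem norm_twirl_mul_self_sub_one_le (h : IsPauliPair x z) (haa : a * a = 1)
    (ha : ‖a - twirl x z a‖ ≤ ε) : ‖twirl x z a * twirl x z a - 1‖ ≤ ε ^ 2 := by
  simpa only [haa, h.twirl_one] using h.norm_twirl_mul_twirl_sub_le ha ha

theorem norm_twirl_anticommutator_le (h : IsPauliPair x z) (ha : ‖a - twirl x z a‖ ≤ ε)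
    (hb : ‖b - twirl x z b‖ ≤ ε) :
    ‖twirl x z a * twirl x z b + twirl x z b * twirl x z a‖ ≤ ‖a * b + b * a‖ + 2 * ε ^ 2 := by
  have decomposition : twirl x z a * twirl x z b + twirl x z b * twirl x z a =
      twirl x z (a * b + b * a) + (twirl x z a * twirl x z b - twirl x z (a * b)) +
        (twirl x z b * twirl x z a - twirl x z (b * a)) := by
    rw [map_add]
    abel
  rw [decomposition]
  refine norm_add₃_le.trans ?_
  linarith [h.norm_twirl_le (a * b + b * a), h.norm_twirl_mul_twirl_sub_le ha hb,
    h.norm_twirl_mul_twirl_sub_le hb ha]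

theorem norm_twirl_commutator_le (h : IsPauliPair x z) (ha : ‖a - twirl x z a‖ ≤ ε)
    (hb : ‖b - twirl x z b‖ ≤ ε) :
    ‖twirl x z a * twirl x z b - twirl x z b * twirl x z a‖ ≤ ‖a * b - b * a‖ + 2 * ε ^ 2 := by
  have decomposition : twirl x z a * twirl x z b - twirl x z b * twirl x z a =
      twirl x z (a * b - b * a) + (twirl x z a * twirl x z b - twirl x z (a * b)) -
        (twirl x z b * twirl x z a - twirl x z (b * a)) := by
    rw [map_sub]
    abel
  rw [decomposition]
  refine (norm_sub_le _ _).trans ?_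
  linarith [norm_add_le (twirl x z (a * b - b * a))
    (twirl x z a * twirl x z b - twirl x z (a * b)), h.norm_twirl_le (a * b - b * a),
    h.norm_twirl_mul_twirl_sub_le ha hb, h.norm_twirl_mul_twirl_sub_le hb ha]

theorem norm_commutator_le_of_near_twirl (h : IsPauliPair x z) {s t : A} (ha : ‖a‖ ≤ 1)
    (ht : ‖t‖ ≤ 1) (hab : ‖a * b - b * a‖ ≤ ε) (hax : ‖a - twirl x z a‖ ≤ ε)
    (hbx : ‖b - twirl x z b‖ ≤ ε) (hs : ‖s - twirl x z a‖ ≤ 7 * ε ^ 2)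
    (htb : ‖t - twirl x z b‖ ≤ 7 * ε ^ 2) : ‖s * t - t * s‖ ≤ ε + 30 * ε ^ 2 := by
  linarith [norm_commutator_le_of_norm_le_one (b := twirl x z b) (s := s)
    ((h.norm_twirl_le a).trans ha) ht, h.norm_twirl_commutator_le hax hbx]

end IsPauliPair

end CStarRing

theorem continuousOn_sign_spectrum {A : Type*} [Ring A] [Algebra ℝ A] {a : A} (ha : IsUnit a) :
    ContinuousOn (fun x : ℝ => (SignType.sign x : ℝ)) (spectrum ℝ a) := fun x hx =>
  have hx0 : x ≠ 0 := by
    rintro rfl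
    exact spectrum.zero_notMem ℝ ha hx
  ((continuous_of_discreteTopology (f := fun s : SignType => (s : ℝ))).continuousAt.comp
    (continuousAt_sign_of_ne_zero hx0)).continuousWithinAt

section CStarAlgebra

variable {A : Type*} [CStarAlgebra A]

/-- The sign of `a` by continuous functional calculus, which is a reflection when `a` is a
self-adjoint unit. The value is the junk value `0` when `a` is not self-adjoint or the sign function
is not continuous on the spectrum of `a`. -/
noncomputable def signPart (a : A) : A := cfc (fun x : ℝ => (SignType.sign x : ℝ)) a

theorem isReflection_signPart {a : A} (ha : IsSelfAdjoint a) (hu : IsUnit a) :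
    IsReflection (signPart a) where
  isSelfAdjoint := cfc_predicate _ _
  mul_self := by
    have hsign := continuousOn_sign_spectrum hu
    rw [signPart, ← cfc_mul _ _ a hsign hsign, ← cfc_one ℝ a]
    refine cfc_congr fun x hx => ?_
    have hx0 : x ≠ 0 := by
      rintro rfl
      exact spectrum.zero_notMem ℝ hu hx
    rcases hx0.lt_or_gt with hx | hx <;> simp [hx]

theorem norm_signPart_sub_le {a : A} (ha : IsSelfAdjoint a) (hu : IsUnit a) :
    ‖signPart a - a‖ ≤ ‖a * a - 1‖ := by
  have hsub : signPart a - a = cfc (fun x : ℝ => (SignType.sign x : ℝ) - x) a := by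
    rw [cfc_sub _ (fun x => x) a (continuousOn_sign_spectrum hu), cfc_id' ℝ a, signPart]
  have hsq : a * a - 1 = cfc (fun x : ℝ => x * x - 1) a := by
    rw [cfc_sub (fun x : ℝ => x * x) (fun _ => 1) a, cfc_mul (fun x : ℝ => x) (fun x => x) a,
      cfc_id' ℝ a, cfc_const_one ℝ a]
  have hpoint (x : ℝ) : |(SignType.sign x : ℝ) - x| ≤ |x * x - 1| := by
    rcases lt_trichotomy x 0 with hx | rfl | hx
    · rw [sign_neg hx, SignType.coe_neg_one, show x * x - 1 = (-1 - x) * (1 - x) by ring, abs_mul]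
      exact le_mul_of_one_le_right (abs_nonneg _) (by rw [le_abs]; left; linarith)
    · simp
    · rw [sign_pos hx, SignType.coe_one, show x * x - 1 = (1 - x) * (-1 - x) by ring, abs_mul]
      exact le_mul_of_one_le_right (abs_nonneg _) (by rw [le_abs]; right; linarith)
  rw [hsub, hsq]
  exact norm_cfc_le (norm_nonneg _) fun x hx =>
    (hpoint x).trans (norm_apply_le_norm_cfc (fun x : ℝ => x * x - 1) a hx)

theorem commute_signPart {y a : A} (h : Commute y a) : Commute y (signPart a) :=
  (h.symm.cfc_real _).symm

theorem signPart_mul_self {a : A} (ha : IsSelfAdjoint a) (hu : IsUnit a) :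
    signPart a * a = cfc Real.sqrt (a ^ 2) :=
  calc signPart a * a = cfc (fun x : ℝ => (SignType.sign x : ℝ)) a * cfc (fun x : ℝ => x) a := by
        rw [signPart, cfc_id' ℝ a]
    _ = cfc (fun x => √(x ^ 2)) a := by
        rw [← cfc_mul _ _ a (continuousOn_sign_spectrum hu)]
        simp only [sign_mul_self, Real.sqrt_sq_eq_abs]
    _ = cfc Real.sqrt (a ^ 2) := cfc_comp_pow Real.sqrt 2 a

theorem anticommute_signPart {y a : A} (ha : IsSelfAdjoint a) (hu : IsUnit a)
    (h : y * a + a * y = 0) : y * signPart a + signPart a * y = 0 := by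
  have ya : y * a = -(a * y) := eq_neg_of_add_eq_zero_left h
  have hsq : Commute (a ^ 2) y := by
    rw [commute_iff_eq, sq, mul_assoc, ← mul_assoc y, ya, neg_mul, mul_assoc, ya, mul_neg, neg_neg]
  have habs : signPart a * a * y = y * (signPart a * a) := by
    rw [signPart_mul_self ha hu, (hsq.cfc_real Real.sqrt).eq]
  refine hu.mul_right_cancel ?_
  rw [zero_mul, add_mul, mul_assoc, ← habs, mul_assoc (signPart a) y, ya, mul_neg, mul_assoc,
    add_neg_cancel]

theorem exists_isPauliPair_near {a b : A} (ha : IsSelfAdjoint a) (hb : IsSelfAdjoint b)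
    (hb1 : ‖b‖ ≤ 1) {δ : ℝ} (hδ : 5 * δ < 1) (haa : ‖a * a - 1‖ ≤ δ) (hbb : ‖b * b - 1‖ ≤ δ)
    (hab : ‖a * b + b * a‖ ≤ 2 * δ) :
    ∃ x z : A, IsPauliPair x z ∧ ‖x - a‖ ≤ 7 * δ ∧ ‖z - b‖ ≤ 7 * δ ∧
      ∀ y, Commute y a → Commute y b → Commute y x ∧ Commute y z := by
  have hδ0 : 0 ≤ δ := (norm_nonneg _).trans haa
  have hua : IsUnit a := isUnit_of_norm_mul_self_sub_one_lt_one (by linarith)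
  set x := signPart a
  -- Anticommutation with `x` passes from `c` to its sign, whereas `b` anticommutes only roughly.
  set c := b - pinch x b with hc_def
  have hx : IsReflection x := isReflection_signPart ha hua
  have hxa : ‖x - a‖ ≤ δ := (norm_signPart_sub_le ha hua).trans haa
  have hcb : ‖c - b‖ ≤ 2 * δ := by
    rw [hc_def, sub_sub_cancel_left, norm_neg, hx.norm_pinch]
    linarith [norm_anticommutator_le_of_norm_le_one (a := a) (x := x) hb1]
  have hcc : ‖c * c - 1‖ ≤ 5 * δ := by
    linarith [norm_mul_self_sub_one_le_of_norm_le_one hb1 ((hx.norm_sub_pinch_le b).trans hb1)]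
  have hc : IsSelfAdjoint c := hb.sub (isSelfAdjoint_pinch hx.isSelfAdjoint hb)
  have huc : IsUnit c := isUnit_of_norm_mul_self_sub_one_lt_one (by linarith)
  refine ⟨x, signPart c, ⟨hx, isReflection_signPart hc huc,
    anticommute_signPart hc huc (sub_pinch_anticommute hx.mul_self b)⟩, by linarith, ?_,
    fun y hya hyb => ?_⟩
  · linarith [norm_signPart_sub_le hc huc, norm_sub_le_norm_sub_add_norm_sub (signPart c) c b]
  · have hyx : Commute y x := commute_signPart hya
    exact ⟨hyx, commute_signPart (hyb.sub_right (commute_pinch_of_commute hyx hyb))⟩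

theorem IsPauliPair.exists_commuting_isPauliPair_near {x z a b : A} (h : IsPauliPair x z)
    (hab : IsPauliPair a b) {ε : ℝ} (hε : 5 * ε ^ 2 < 1) (ha : ‖a - twirl x z a‖ ≤ ε)
    (hb : ‖b - twirl x z b‖ ≤ ε) :
    ∃ a' b' : A, IsPauliPair a' b' ∧ ‖a' - twirl x z a‖ ≤ 7 * ε ^ 2 ∧
      ‖b' - twirl x z b‖ ≤ 7 * ε ^ 2 ∧
      (Commute x a' ∧ Commute x b') ∧ Commute z a' ∧ Commute z b' := by
  have hanti := h.norm_twirl_anticommutator_le ha hb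
  rw [hab.anticommute, norm_zero, zero_add] at hanti
  obtain ⟨a', b', hab', ha', hb', hcomm⟩ := exists_isPauliPair_near
    (h.isSelfAdjoint_twirl hab.left.isSelfAdjoint) (h.isSelfAdjoint_twirl hab.right.isSelfAdjoint)
    ((h.norm_twirl_le b).trans hab.right.norm_le_one) hε
    (h.norm_twirl_mul_self_sub_one_le hab.left.mul_self ha)
    (h.norm_twirl_mul_self_sub_one_le hab.right.mul_self hb) hanti
  exact ⟨a', b', hab', ha', hb', hcomm x (h.commute_left_twirl a) (h.commute_left_twirl b),
    hcomm z (h.commute_right_twirl a) (h.commute_right_twirl b)⟩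

end CStarAlgebra

section Restrict

variable {H : Type*} [NormedAddCommGroup H] [InnerProductSpace ℂ H] {K : Submodule ℂ H}

theorem isSelfAdjoint_restrict [CompleteSpace H] [CompleteSpace K] {a : H →L[ℂ] H}
    (ha : IsSelfAdjoint a) (haK : ∀ v ∈ K, a v ∈ K) : IsSelfAdjoint (a.restrict haK) := by
  rw [ContinuousLinearMap.isSelfAdjoint_iff_isSymmetric] at ha ⊢
  exact ha.restrict_invariant haK

theorem norm_restrict_le {a : H →L[ℂ] H} (haK : ∀ v ∈ K, a v ∈ K) : ‖a.restrict haK‖ ≤ ‖a‖ :=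
  ContinuousLinearMap.opNorm_le_bound _ (norm_nonneg a) fun v => a.le_opNorm v

theorem norm_restrict_commutator_le {a b : H →L[ℂ] H} (ha : ∀ v ∈ K, a v ∈ K)
    (hb : ∀ v ∈ K, b v ∈ K) :
    ‖a.restrict ha * b.restrict hb - b.restrict hb * a.restrict ha‖ ≤ ‖a * b - b * a‖ :=
  norm_restrict_le (a := a * b - b * a)
    fun v hv => K.sub_mem (ha _ (hb v hv)) (hb _ (ha v hv))

end Restrict

namespace Qubit

variable {H : Type*} [NormedAddCommGroup H] [InnerProductSpace ℂ H] [CompleteSpace H]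

theorem isPauliPair (q : Qubit H) : IsPauliPair q.X q.Z :=
  ⟨⟨q.isReflection_X.1, q.isReflection_X.2⟩, ⟨q.isReflection_Z.1, q.isReflection_Z.2⟩,
    q.anticommute⟩

theorem overlap_le_iff {p q : Qubit H} {ε : ℝ} : p.overlap q ≤ ε ↔
    (‖p.X * q.X - q.X * p.X‖ ≤ ε ∧ ‖p.X * q.Z - q.Z * p.X‖ ≤ ε) ∧
      ‖p.Z * q.X - q.X * p.Z‖ ≤ ε ∧ ‖p.Z * q.Z - q.Z * p.Z‖ ≤ ε := by
  simp only [overlap, max_le_iff]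

theorem overlap_nonneg (p q : Qubit H) : 0 ≤ p.overlap q :=
  (norm_nonneg _).trans (overlap_le_iff.1 le_rfl).1.1

theorem overlap_eq_zero_iff {p q : Qubit H} : p.overlap q = 0 ↔
    (Commute p.X q.X ∧ Commute p.X q.Z) ∧ Commute p.Z q.X ∧ Commute p.Z q.Z := by
  rw [← (overlap_nonneg p q).ge_iff_eq', overlap_le_iff]
  simp only [norm_le_zero_iff, sub_eq_zero, commute_iff_eq]

theorem norm_sub_twirl_le (p q : Qubit H) : ‖q.X - twirl p.X p.Z q.X‖ ≤ p.overlap q ∧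
    ‖q.Z - twirl p.X p.Z q.Z‖ ≤ p.overlap q := by
  obtain ⟨⟨hXX, hXZ⟩, hZX, hZZ⟩ := overlap_le_iff.1 (le_refl (p.overlap q))
  exact ⟨p.isPauliPair.norm_sub_twirl_le hXX hZX, p.isPauliPair.norm_sub_twirl_le hXZ hZZ⟩

theorem exists_near_twirl_overlap_eq_zero {p q : Qubit H} {ε : ℝ} (hε : 5 * ε ^ 2 < 1)
    (h : p.overlap q ≤ ε) : ∃ q' : Qubit H, p.overlap q' = 0 ∧
      ‖q'.X - twirl p.X p.Z q.X‖ ≤ 7 * ε ^ 2 ∧ ‖q'.Z - twirl p.X p.Z q.Z‖ ≤ 7 * ε ^ 2 := by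
  obtain ⟨hX, hZ⟩ := norm_sub_twirl_le p q
  obtain ⟨X', Z', h', hX', hZ', hcomm⟩ := p.isPauliPair.exists_commuting_isPauliPair_near
    q.isPauliPair hε (hX.trans h) (hZ.trans h)
  exact ⟨⟨X', Z', ⟨h'.left.isSelfAdjoint, h'.left.mul_self⟩,
    ⟨h'.right.isSelfAdjoint, h'.right.mul_self⟩, h'.anticommute⟩,
    overlap_eq_zero_iff.2 hcomm, hX', hZ'⟩

theorem overlap_le_of_near_twirl {p q r q' r' : Qubit H} {ε : ℝ} (hpq : p.overlap q ≤ ε)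
    (hpr : p.overlap r ≤ ε) (hqr : q.overlap r ≤ ε)
    (hqX : ‖q'.X - twirl p.X p.Z q.X‖ ≤ 7 * ε ^ 2) (hqZ : ‖q'.Z - twirl p.X p.Z q.Z‖ ≤ 7 * ε ^ 2)
    (hrX : ‖r'.X - twirl p.X p.Z r.X‖ ≤ 7 * ε ^ 2)
    (hrZ : ‖r'.Z - twirl p.X p.Z r.Z‖ ≤ 7 * ε ^ 2) : q'.overlap r' ≤ ε + 30 * ε ^ 2 := by
  obtain ⟨⟨hXX, hXZ⟩, hZX, hZZ⟩ := overlap_le_iff.1 hqr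
  have hp := p.isPauliPair
  have hX1 := q.isPauliPair.left.norm_le_one
  have hZ1 := q.isPauliPair.right.norm_le_one
  have hX1' := r'.isPauliPair.left.norm_le_one
  have hZ1' := r'.isPauliPair.right.norm_le_one
  have hq := norm_sub_twirl_le p q
  have hr := norm_sub_twirl_le p r
  have hqXp := hq.1.trans hpq
  have hqZp := hq.2.trans hpq
  have hrXp := hr.1.trans hpr
  have hrZp := hr.2.trans hpr
  exact overlap_le_iff.2
    ⟨⟨hp.norm_commutator_le_of_near_twirl hX1 hX1' hXX hqXp hrXp hqX hrX,
      hp.norm_commutator_le_of_near_twirl hX1 hZ1' hXZ hqXp hrZp hqX hrZ⟩,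
      hp.norm_commutator_le_of_near_twirl hZ1 hX1' hZX hqZp hrXp hqZ hrX,
      hp.norm_commutator_le_of_near_twirl hZ1 hZ1' hZZ hqZp hrZp hqZ hrZ⟩

theorem exists_overlap_eq_zero {ι : Type*} {p : Qubit H} {q : ι → Qubit H} {ε : ℝ}
    (hε : 5 * ε ^ 2 < 1) (hp : ∀ i, p.overlap (q i) ≤ ε)
    (hq : ∀ i j, i ≠ j → (q i).overlap (q j) ≤ ε) :
    ∃ q' : ι → Qubit H, (∀ i, p.overlap (q' i) = 0) ∧
      ∀ i j, i ≠ j → (q' i).overlap (q' j) ≤ ε + 30 * ε ^ 2 := by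
  choose q' hdisjoint hX hZ using fun i => exists_near_twirl_overlap_eq_zero hε (hp i)
  exact ⟨q', hdisjoint, fun i j hij =>
    overlap_le_of_near_twirl (hp i) (hp j) (hq i j hij) (hX i) (hZ i) (hX j) (hZ j)⟩

/-- The qubit on a closed subspace invariant under both reflections of a given qubit. -/
def restrict (q : Qubit H) (K : Submodule ℂ H) [CompleteSpace K] (hX : ∀ v ∈ K, q.X v ∈ K)
    (hZ : ∀ v ∈ K, q.Z v ∈ K) : Qubit K where
  X := q.X.restrict hX
  Z := q.Z.restrict hZ
  isReflection_X := ⟨isSelfAdjoint_restrict q.isReflection_X.1 hX, by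
    ext v
    exact DFunLike.congr_fun q.isReflection_X.2 (v : H)⟩
  isReflection_Z := ⟨isSelfAdjoint_restrict q.isReflection_Z.1 hZ, by
    ext v
    exact DFunLike.congr_fun q.isReflection_Z.2 (v : H)⟩
  anticommute := by
    ext v
    exact DFunLike.congr_fun q.anticommute (v : H)

theorem overlap_restrict_le {q r : Qubit H} {K : Submodule ℂ H} [CompleteSpace K]
    (hqX : ∀ v ∈ K, q.X v ∈ K) (hqZ : ∀ v ∈ K, q.Z v ∈ K) (hrX : ∀ v ∈ K, r.X v ∈ K)
    (hrZ : ∀ v ∈ K, r.Z v ∈ K) :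
    (q.restrict K hqX hqZ).overlap (r.restrict K hrX hrZ) ≤ q.overlap r :=
  max_le_max
    (max_le_max (norm_restrict_commutator_le hqX hrX) (norm_restrict_commutator_le hqX hrZ))
    (max_le_max (norm_restrict_commutator_le hqZ hrX) (norm_restrict_commutator_le hqZ hrZ))

/-- The `1`-eigenspace of the second reflection of a qubit, on which the operators that commute with
the qubit act. -/
def plusSpace (q : Qubit H) : Submodule ℂ H := Module.End.eigenspace (q.Z : Module.End ℂ H) 1

theorem mem_plusSpace {q : Qubit H} {v : H} : v ∈ q.plusSpace ↔ q.Z v = v := by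
  simp [plusSpace]

instance (q : Qubit H) : CompleteSpace q.plusSpace :=
  have eq_fixed : (q.plusSpace : Set H) = {v | q.Z v = v} := Set.ext fun _ => mem_plusSpace
  have closed : IsClosed (q.plusSpace : Set H) :=
    eq_fixed ▸ isClosed_eq q.Z.continuous continuous_id
  closed.completeSpace_coe

theorem apply_mem_plusSpace_of_commute {q : Qubit H} {a : H →L[ℂ] H} (h : Commute q.Z a) :
    ∀ v ∈ q.plusSpace, a v ∈ q.plusSpace := fun v hv => by
  have hZa : q.Z (a v) = a (q.Z v) := DFunLike.congr_fun h.eq v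
  rw [mem_plusSpace, hZa, mem_plusSpace.1 hv]

theorem exists_plusSpace_overlap_le {ι : Type*} {p : Qubit H} {q : ι → Qubit H} {ε : ℝ}
    (hε : 5 * ε ^ 2 < 1) (hp : ∀ i, p.overlap (q i) ≤ ε)
    (hq : ∀ i j, i ≠ j → (q i).overlap (q j) ≤ ε) :
    ∃ q' : ι → Qubit p.plusSpace, ∀ i j, i ≠ j → (q' i).overlap (q' j) ≤ ε + 30 * ε ^ 2 := by
  obtain ⟨r, hpr, hr⟩ := exists_overlap_eq_zero hε hp hq
  have hX i := apply_mem_plusSpace_of_commute (overlap_eq_zero_iff.1 (hpr i)).2.1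
  have hZ i := apply_mem_plusSpace_of_commute (overlap_eq_zero_iff.1 (hpr i)).2.2
  exact ⟨fun i => (r i).restrict p.plusSpace (hX i) (hZ i), fun i j hij =>
    (overlap_restrict_le _ _ _ _).trans (hr i j hij)⟩

theorem trace_Z (q : Qubit H) : LinearMap.trace ℂ H (q.Z : H →ₗ[ℂ] H) = 0 := by
  have conj : (q.X * q.Z * q.X : H →L[ℂ] H) = -q.Z := by
    rw [eq_neg_of_add_eq_zero_left q.anticommute, neg_mul, mul_assoc, q.isReflection_X.2, mul_one]
  have X_mul_X : (q.X : Module.End ℂ H) * q.X = 1 :=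
    congrArg ContinuousLinearMap.toLinearMap q.isReflection_X.2
  have trace_eq_neg : LinearMap.trace ℂ H (q.Z : Module.End ℂ H) =
      -LinearMap.trace ℂ H (q.Z : Module.End ℂ H) :=
    calc LinearMap.trace ℂ H (q.Z : Module.End ℂ H)
        = LinearMap.trace ℂ H ((q.X : Module.End ℂ H) * q.Z * q.X) := by
          rw [LinearMap.trace_mul_comm, ← mul_assoc, X_mul_X, one_mul]
      _ = LinearMap.trace ℂ H ((-q.Z : H →L[ℂ] H) : Module.End ℂ H) := by
          rw [← conj]; rfl
      _ = -LinearMap.trace ℂ H (q.Z : Module.End ℂ H) := map_neg _ _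
  exact self_eq_neg.1 trace_eq_neg

theorem two_mul_finrank_plusSpace (q : Qubit H) [FiniteDimensional ℂ H] :
    2 * Module.finrank ℂ q.plusSpace = Module.finrank ℂ H := by
  let f : Module.End ℂ H := (1 / 2 : ℂ) • (1 + (q.Z : Module.End ℂ H))
  have hf : LinearMap.IsProj q.plusSpace f := by
    refine ⟨fun v => mem_plusSpace.2 ?_, fun v hv => ?_⟩
    · have hZZ : q.Z (q.Z v) = v := DFunLike.congr_fun q.isReflection_Z.2 v
      simp [f, hZZ, add_comm]
    · simp only [f, LinearMap.smul_apply, LinearMap.add_apply, Module.End.one_apply,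
        ContinuousLinearMap.coe_coe, mem_plusSpace.1 hv]
      module
  have htrace : LinearMap.trace ℂ H f = (1 / 2 : ℂ) * Module.finrank ℂ H := by
    rw [map_smul, map_add, LinearMap.trace_one, q.trace_Z, add_zero, smul_eq_mul]
  have hcast : (2 * Module.finrank ℂ q.plusSpace : ℂ) = Module.finrank ℂ H := by
    rw [← hf.trace, htrace]
    ring
  exact_mod_cast hcast

end Qubit

theorem mul_le_one_of_div_sq_le {ε c : ℝ} (hc : 0 ≤ c) (hε : ε < 1)
    (h : ε / (1 - ε) ^ 2 ≤ 1 / c) : c * ε ≤ 1 := by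
  rcases hc.eq_or_lt with rfl | hc_pos
  · simp
  rcases le_total ε 0 with hε0 | hε0
  · exact (mul_nonpos_of_nonneg_of_nonpos hc hε0).trans zero_le_one
  · have hsq : (1 - ε) ^ 2 ≤ 1 := pow_le_one₀ (by linarith) (by linarith)
    have hle : ε ≤ 1 / c := (le_div_self hε0 (by nlinarith) hsq).trans h
    rwa [le_div_iff₀' hc_pos] at hle

theorem mul_add_mul_sq_le_one {ε c n : ℝ} (hc : 0 ≤ c) (hε : 0 ≤ ε)
    (h : c * (n + 1) * ε ≤ 1) : c * n * (ε + c * ε ^ 2) ≤ 1 := by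
  calc c * n * (ε + c * ε ^ 2) = (c * (n + 1) * ε - c * ε) * (1 + c * ε) := by ring
    _ ≤ (1 - c * ε) * (1 + c * ε) := by gcongr
    _ ≤ 1 := by nlinarith [sq_nonneg (c * ε)]

theorem mainTheorem3_general {H : Type*} [NormedAddCommGroup H] [InnerProductSpace ℂ H]
    [CompleteSpace H] {n : ℕ} (hdim : ¬ 2 ^ (n + 1) ∣ Module.finrank ℂ H) {ε : ℝ}
    (hε : 30 * n * ε ≤ 1) {m : ℕ} (q : Fin m → Qubit H)
    (hq : ∀ i j : Fin m, i ≠ j → (q i).overlap (q j) ≤ ε) : m ≤ n := by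
  have hfinite : FiniteDimensional ℂ H :=
    Module.finite_of_finrank_pos (Nat.pos_of_ne_zero fun h => hdim (h ▸ dvd_zero _))
  induction n generalizing H m ε with
  | zero =>
    obtain _ | m := m
    · rfl
    · exact absurd ⟨_, (q 0).two_mul_finrank_plusSpace.symm⟩ hdim
  | succ n ih =>
    obtain _ | _ | m := m
    · omega
    · omega
    have hε0 : 0 ≤ ε := ((q 0).overlap_nonneg (q 1)).trans (hq 0 1 Fin.zero_ne_one)
    push_cast at hε
    have hε_small : 30 * ε ≤ 1 := by linarith [mul_nonneg n.cast_nonneg hε0]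
    obtain ⟨q', hq'⟩ := Qubit.exists_plusSpace_overlap_le (p := q 0) (q := fun i => q i.succ)
      (by nlinarith) (fun i => hq _ _ (Fin.succ_ne_zero i).symm)
      fun i j hij => hq _ _ ((Fin.succ_injective _).ne hij)
    rw [← (q 0).two_mul_finrank_plusSpace, pow_succ', Nat.mul_dvd_mul_iff_left two_pos] at hdim
    exact Nat.succ_le_succ
      (ih hdim (mul_add_mul_sq_le_one (by norm_num) hε0 hε) q' hq' inferInstance)

theorem mainTheorem3 {H : Type*} [NormedAddCommGroup H] [InnerProductSpace ℂ H]
    [CompleteSpace H] (n : ℕ) (hn : 1 ≤ n) (hdim : Module.finrank ℂ H = 2 ^ n)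
    (ε : ℝ) (hε_lt : ε < 1) (hε : ε / (1 - ε) ^ 2 ≤ 1 / (64 * (n : ℝ)))
    (m : ℕ) (q : Fin m → Qubit H)
    (hq : ∀ i j : Fin m, i ≠ j → (q i).overlap (q j) ≤ ε) :
    m ≤ n := by
  have hn_mul : 64 * n * ε ≤ 1 := mul_le_one_of_div_sq_le (by positivity) hε_lt hε
  exact mainTheorem3_general (by simp [hdim, Nat.pow_dvd_pow_iff_le_right']) (by linarith) q hq
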